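/- Let $J$ be a finite set of jobs, where job $j$ has a processing time $p_j>0$ and a release date $r_j\ge 0$, and let $\alpha\in[0,1)$. A (feasible, preemptive) schedule on a single machine of unit speed processes, at each time, jobs that have already been released at nonnegative rates of total at most $1$, and processes every job $j$ for exactly $p_j$ units in total. For a given schedule, $y_j(t)$ denotes the amount of processing that $j$ has received until time $t$, $p_j(t)=p_j-y_j(t)$ its remaining processing time, $C_j$ its completion time, and $\{j : r_j\le t<C_j\}$ is the set of jobs alive at time $t$. The signal time $s_j$ is the earliest time from $r_j$ on at which $y_j=\alpha p_j$. Consider a schedule of the following algorithm. Let $A(t)$ be the set of jobs alive at time $t$ in it, and put $N(t)=\{j\in A(t): y_j(t)\le \alpha p_j\}$ and $C(t)=\{j\in A(t): y_j(t)>\alpha p_j\}$; if $\alpha=0$, all jobs are known at arrival and we put instead $N(t)=\emptyset$ and $C(t)=A(t)$. At every time $t$ (with $\min\emptyset=\infty$): 1. if $C(t)\neq\emptyset$ and $\min_{j\in C(t)}p_j(t)\le \frac{1-\alpha}{\alpha}\min_{j\in N(t)}y_j(t)$ (a condition that always holds if $N(t)=\emptyset$), the algorithm processes at rate $1$ a job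 of $C(t)$ with smallest remaining processing time, choosing among several such jobs one with maximum $s_j$ and breaking remaining ties arbitrarily; 2. otherwise it processes all jobs of $N(t)$ with the smallest $y_j(t)$ at equal rates of total $1$ (and idles if $N(t)=\emptyset$). Fix any schedule of the same instance that minimizes the total flow time $\sum_j (C_j-r_j)$ among all schedules, and let $O(t)$ be the set of jobs alive in it at time $t$. Then, at every time $t$, $$|A(t)\setminus O(t)|\le\Big(3+\frac{2}{1-\alpha}\Big)\,|O(t)|.$$ -/

import Mathlib

/-- An instance of single-machine scheduling with job set `J`: every job has a positive
processing time `p j` and a release date `r j ≥ 0`. -/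
structure SchedInstance (J : Type*) where
  p : J → ℝ
  r : J → ℝ
  p_pos : ∀ j, 0 < p j
  r_nonneg : ∀ j, 0 ≤ r j

/-- A feasible preemptive schedule on one machine of speed `1`. At time `u` job `j` is processed at
rate `rate j u`, so that several jobs may share the machine. No job is processed before its
release, no job receives more than its processing time, and every job is eventually completed. -/
structure Schedule {J : Type*} [Fintype J] (I : SchedInstance J) where
  rate : J → ℝ → ℝ
  measurable_rate : ∀ j, Measurable (rate j)
  rate_nonneg : ∀ j u, 0 ≤ rate j u
  sum_rate_le_one : ∀ u, ∑ j, rate j u ≤ 1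
  rate_eq_zero_of_lt_release : ∀ j u, u < I.r j → rate j u = 0
  processed_le : ∀ j t, ∫ u in (0 : ℝ)..t, rate j u ≤ I.p j
  completes : ∀ j, ∃ t, ∫ u in (0 : ℝ)..t, rate j u = I.p j

noncomputable section

namespace Schedule

variable {J : Type*} [Fintype J] {I : SchedInstance J}

/-- `y_j(t)`: the amount of processing that `j` has received until time `t`. -/
def y (S : Schedule I) (j : J) (t : ℝ) : ℝ := ∫ u in (0 : ℝ)..t, S.rate j u

/-- `p_j(t) = p_j - y_j(t)`: the remaining processing time of `j` at time `t`. -/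
def rem (S : Schedule I) (j : J) (t : ℝ) : ℝ := I.p j - S.y j t

/-- `C_j`: the completion time of `j`, i.e. the earliest time at which `j` is fully processed. -/
def completion (S : Schedule I) (j : J) : ℝ := sInf {t | S.y j t = I.p j}

/-- The total flow time `∑_j (C_j - r_j)`. -/
def totalFlow (S : Schedule I) : ℝ := ∑ j, (S.completion j - I.r j)

/-- The schedule minimizes the total flow time among all feasible schedules of the instance. -/
def IsOptimal (S : Schedule I) : Prop := ∀ S' : Schedule I, S.totalFlow ≤ S'.totalFlow

open Classical in
/-- The set `{j | r_j ≤ t < C_j}` of jobs that are alive (available) at time `t`. -/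
def alive (S : Schedule I) (t : ℝ) : Finset J :=
  Finset.univ.filter fun j => I.r j ≤ t ∧ t < S.completion j

/-- `s_j`: the time at which `j` emits its signal, i.e. the earliest time (from its release on) at
which an `α`-fraction of `j` has been processed. -/
def emission (S : Schedule I) (α : ℝ) (j : J) : ℝ :=
  sInf {t | I.r j ≤ t ∧ S.y j t = α * I.p j}

open Classical in
/-- `N(t)`: the non-clairvoyant jobs, i.e. the alive jobs with `y_j(t) ≤ α p_j`. For `α = 0` (the
clairvoyant model) processing times are known at arrival, and there are no such jobs. -/
def nonclairvoyant (S : Schedule I) (α t : ℝ) : Finset J :=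
  (S.alive t).filter fun j => α ≠ 0 ∧ S.y j t ≤ α * I.p j

open Classical in
/-- `C(t)`: the clairvoyant jobs, i.e. the alive jobs with `y_j(t) > α p_j` (all alive jobs if
`α = 0`). -/
def clairvoyant (S : Schedule I) (α t : ℝ) : Finset J :=
  (S.alive t).filter fun j => α = 0 ∨ α * I.p j < S.y j t

/-- The condition `min_{k ∈ C(t)} p_k(t) ≤ (1-α)/α * min_{j ∈ N(t)} y_j(t)`, where the minimum over
the empty set is `∞` (and the condition is not met if `C(t)` is empty). -/
def PrefersClairvoyant (S : Schedule I) (α t : ℝ) : Prop :=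
  ∃ k ∈ S.clairvoyant α t, ∀ j ∈ S.nonclairvoyant α t, S.rem k t ≤ (1 - α) / α * S.y j t

/-- At time `t` the machine only processes one job of `C(t)`, namely one with the smallest remaining
processing time, and among these one that emitted last; other ties are broken arbitrarily. -/
def RunsSRPT (S : Schedule I) (α t : ℝ) : Prop :=
  ∃ k ∈ S.clairvoyant α t,
    (∀ j ∈ S.clairvoyant α t, S.rem k t ≤ S.rem j t) ∧
    (∀ j ∈ S.clairvoyant α t, S.rem j t = S.rem k t → S.emission α j ≤ S.emission α k) ∧
    S.rate k t = 1 ∧ ∀ j, j ≠ k → S.rate j t = 0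

open Classical in
/-- The jobs of `N(t)` that have received the smallest amount of processing so far. -/
def leastProcessed (S : Schedule I) (α t : ℝ) : Finset J :=
  (S.nonclairvoyant α t).filter fun j => ∀ i ∈ S.nonclairvoyant α t, S.y j t ≤ S.y i t

/-- At time `t` the machine is shared evenly among the jobs of `N(t)` that have received the
smallest amount of processing so far (and it is idle if `N(t)` is empty). -/
def RunsSETF (S : Schedule I) (α t : ℝ) : Prop :=
  (∀ j ∈ S.leastProcessed α t, S.rate j t = 1 / ((S.leastProcessed α t).card : ℝ)) ∧
  ∀ j, j ∉ S.leastProcessed α t → S.rate j t = 0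

/-- `S` is a schedule of the `α`-clairvoyant algorithm: at every time `t` it runs SRPT on `C(t)` if
`min_{C(t)} p_k(t) ≤ (1-α)/α * min_{N(t)} y_j(t)`, and SETF on `N(t)` otherwise. -/
def IsAlgorithmSchedule (S : Schedule I) (α : ℝ) : Prop :=
  ∀ t, 0 ≤ t →
    (S.PrefersClairvoyant α t → S.RunsSRPT α t) ∧ (¬ S.PrefersClairvoyant α t → S.RunsSETF α t)

end Schedule

end

open MeasureTheory Set Filter Topology

/-- If `f` is a primitive of `h` that starts above `c`, and `h` is nonnegative almost everywhere
where `f` lies in `(l, c)`, then `f` stays above `c`. -/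
theorem le_of_ae_nonneg_of_mem_Ioo {f h : ℝ → ℝ} (hf : Continuous f)
    (hfh : ∀ a b, f b - f a = ∫ u in a..b, h u) {a b l c : ℝ} (hab : a ≤ b) (hlc : l < c)
    (ha : c ≤ f a) (hh : ∀ᵐ u, u ∈ Ioc a b → l < f u → f u < c → 0 ≤ h u) : c ≤ f b := by
  by_contra! hb
  set T : Set ℝ := Icc a b ∩ {u | c ≤ f u} with hT
  have hTc : IsCompact T := isCompact_Icc.inter_right (isClosed_le continuous_const hf)
  have hTne : T.Nonempty := ⟨a, ⟨le_rfl, hab⟩, ha⟩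
  obtain ⟨⟨hav, hvb⟩, hcv⟩ := hTc.sSup_mem hTne
  set v := sSup T
  have hcv : c ≤ f v := hcv
  have hvb' : v < b := lt_of_le_of_ne hvb fun h => by rw [h] at hcv; linarith
  have hev : ∀ᶠ u in 𝓝 v, l < f u := hf.continuousAt.eventually_const_lt (hlc.trans_le hcv)
  obtain ⟨ε, hε, hball⟩ := Metric.eventually_nhds_iff.1 hev
  set w := min b (v + ε / 2)
  have hvw : v < w := lt_min hvb' (by linarith)
  have hwb : w ≤ b := min_le_left _ _
  have hlt : ∀ u, v < u → u ≤ b → f u < c := by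
    intro u hvu hub
    by_contra! hcu
    have : u ≤ v := le_csSup hTc.bddAbove ⟨⟨hav.trans hvu.le, hub⟩, hcu⟩
    linarith
  have hint : 0 ≤ ∫ u in v..w, h u := by
    rw [intervalIntegral.integral_of_le hvw.le]
    refine setIntegral_nonneg_of_ae_restrict ?_
    rw [EventuallyLE, ae_restrict_iff' measurableSet_Ioc]
    filter_upwards [hh] with u hu huvw
    refine hu ⟨hav.trans_lt huvw.1, huvw.2.trans hwb⟩ (hball ?_) (hlt u huvw.1 (huvw.2.trans hwb))
    have : u ≤ v + ε / 2 := huvw.2.trans (min_le_right _ _)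
    rw [Real.dist_eq, abs_lt]
    constructor <;> linarith [huvw.1]
  linarith [hfh v w, hlt w hvw hwb]

namespace Schedule

variable {J : Type*} [Fintype J] {I : SchedInstance J} (S : Schedule I)

theorem rate_le_one (j : J) (u : ℝ) : S.rate j u ≤ 1 :=
  (Finset.single_le_sum (f := fun i => S.rate i u) (fun i _ => S.rate_nonneg i u)
    (Finset.mem_univ j)).trans (S.sum_rate_le_one u)

theorem intervalIntegrable_rate (j : J) (a b : ℝ) : IntervalIntegrable (S.rate j) volume a b := by
  refine (intervalIntegrable_const (c := (1 : ℝ))).mono_fun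
    (S.measurable_rate j).aestronglyMeasurable (Eventually.of_forall fun u => ?_)
  change ‖S.rate j u‖ ≤ ‖(1 : ℝ)‖
  rw [Real.norm_of_nonneg (S.rate_nonneg j u)]
  simpa using S.rate_le_one j u

theorem y_sub_y (j : J) (a b : ℝ) : S.y j b - S.y j a = ∫ u in a..b, S.rate j u :=
  intervalIntegral.integral_interval_sub_left (S.intervalIntegrable_rate j _ _)
    (S.intervalIntegrable_rate j _ _)

theorem continuous_y (j : J) : Continuous (S.y j) :=
  intervalIntegral.continuous_primitive (S.intervalIntegrable_rate j) 0

theorem continuous_rem (j : J) : Continuous (S.rem j) :=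
  continuous_const.sub (S.continuous_y j)

theorem y_mono (j : J) : Monotone (S.y j) := fun a b hab => by
  have := intervalIntegral.integral_nonneg hab (μ := volume) fun u _ => S.rate_nonneg j u
  linarith [S.y_sub_y j a b]

theorem y_eq_zero {j : J} {u : ℝ} (hu : u ≤ I.r j) : S.y j u = 0 := by
  have hzero : ∀ a b, a ≤ b → b ≤ I.r j → ∫ v in a..b, S.rate j v = 0 := by
    intro a b hab hb
    refine intervalIntegral.integral_zero_ae ?_
    have hne : ∀ᵐ v : ℝ, v ≠ b := by simp [ae_iff, measure_singleton]
    filter_upwards [hne] with v hv hmem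
    rw [uIoc_of_le hab] at hmem
    exact S.rate_eq_zero_of_lt_release j v ((lt_of_le_of_ne hmem.2 hv).trans_le hb)
  rcases le_total 0 u with h | h
  · exact hzero 0 u h hu
  · rw [y, intervalIntegral.integral_symm, hzero u 0 h (I.r_nonneg j), neg_zero]

theorem y_le (j : J) (u : ℝ) : S.y j u ≤ I.p j := S.processed_le j u

theorem y_nonneg (j : J) (u : ℝ) : 0 ≤ S.y j u := by
  rcases le_total u (I.r j) with h | h
  · exact (S.y_eq_zero h).ge
  · exact (S.y_eq_zero le_rfl).ge.trans (S.y_mono j h)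

theorem lt_completion_iff (j : J) (u : ℝ) : u < S.completion j ↔ S.y j u < I.p j := by
  have hpos : ∀ v, S.y j v = I.p j → I.r j ≤ v := fun v hv => by
    by_contra! h
    have := I.p_pos j
    rw [S.y_eq_zero h.le] at hv
    linarith
  have hbdd : BddBelow {v | S.y j v = I.p j} := ⟨I.r j, fun v hv => hpos v hv⟩
  constructor
  · intro h
    refine lt_of_le_of_ne (S.y_le j u) fun heq => ?_
    exact absurd (csInf_le hbdd heq) (not_le.2 h)
  · intro h
    have hmem : S.completion j ∈ {v | S.y j v = I.p j} :=
      (isClosed_eq (S.continuous_y j) continuous_const).csInf_mem (S.completes j) hbdd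
    by_contra! hle
    have h1 : S.y j (S.completion j) = I.p j := hmem
    linarith [S.y_mono j hle]

theorem mem_alive {j : J} {u : ℝ} : j ∈ S.alive u ↔ I.r j ≤ u ∧ S.y j u < I.p j := by
  simp [alive, S.lt_completion_iff]

theorem ae_hasDerivAt_y (j : J) : ∀ᵐ u, HasDerivAt (S.y j) (S.rate j u) u := by
  have hloc : LocallyIntegrable (S.rate j) volume := by
    refine (locallyIntegrable_const (1 : ℝ)).mono (S.measurable_rate j).aestronglyMeasurable
      (Eventually.of_forall fun u => ?_)
    rw [Real.norm_of_nonneg (S.rate_nonneg j u)]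
    simpa using S.rate_le_one j u
  filter_upwards [LocallyIntegrable.ae_hasDerivAt_integral hloc] with u hu using hu 0

/-- `y_j` does not grow past `a` if `j` is not processed while `y_j` lies in `(a, b)`. -/
theorem y_le_of_ae_rate_eq_zero {j : J} {s t a b : ℝ} (hst : s ≤ t) (hab : a < b)
    (hs : S.y j s ≤ a) (h : ∀ᵐ u, u ∈ Ioc s t → a < S.y j u → S.y j u < b → S.rate j u = 0) :
    S.y j t ≤ a := by
  have := le_of_ae_nonneg_of_mem_Ioo (f := fun u => - S.y j u) (h := fun u => - S.rate j u)
    (S.continuous_y j).neg (fun a b => by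
      rw [intervalIntegral.integral_neg, ← S.y_sub_y]; ring) hst (neg_lt_neg hab) (neg_le_neg hs)
    (by
      filter_upwards [h] with u hu hmem h1 h2
      rw [hu hmem (by linarith) (by linarith), neg_zero])
  linarith

theorem sum_y_sub_y_le (s t : ℝ) (hst : s ≤ t) : ∑ j, (S.y j t - S.y j s) ≤ t - s := by
  simp_rw [S.y_sub_y]
  rw [← intervalIntegral.integral_finsetSum fun j _ => S.intervalIntegrable_rate j s t]
  have hint : IntervalIntegrable (fun u => ∑ j, S.rate j u) volume s t := by
    simpa only [Finset.sum_fn] using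
      IntervalIntegrable.sum Finset.univ fun j _ => S.intervalIntegrable_rate j s t
  calc ∫ u in s..t, ∑ j, S.rate j u ≤ ∫ _ in s..t, (1 : ℝ) :=
        intervalIntegral.integral_mono hst
          hint intervalIntegrable_const S.sum_rate_le_one
    _ = t - s := by simp

theorem sum_y_sub_y_eq {s t : ℝ} (hst : s ≤ t) (h : ∀ u ∈ Ioc s t, ∑ j, S.rate j u = 1) :
    ∑ j, (S.y j t - S.y j s) = t - s := by
  simp_rw [S.y_sub_y]
  rw [← intervalIntegral.integral_finsetSum fun j _ => S.intervalIntegrable_rate j s t,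
    intervalIntegral.integral_congr_ae (g := fun _ => (1 : ℝ))]
  · simp
  · refine Eventually.of_forall fun u hu => ?_
    rw [uIoc_of_le hst] at hu
    exact h u hu

end Schedule

namespace Schedule

variable {J : Type*} [Fintype J] {I : SchedInstance J} (S : Schedule I)

/-- The priority of `j`: its remaining processing time or, if smaller, `(1-α)/α` times the
processing it has received. The algorithm always processes alive jobs of smallest priority. -/
noncomputable def priority (α : ℝ) (j : J) (u : ℝ) : ℝ :=
  if α = 0 then S.rem j u else min ((1 - α) / α * S.y j u) (S.rem j u)

variable {S} {α : ℝ}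

theorem continuous_priority (j : J) : Continuous (S.priority α j) := by
  unfold priority
  split_ifs
  · exact S.continuous_rem j
  · exact (continuous_const.mul (S.continuous_y j)).min (S.continuous_rem j)

theorem priority_le_rem (j : J) (u : ℝ) : S.priority α j u ≤ S.rem j u := by
  unfold priority
  split_ifs
  · exact le_rfl
  · exact min_le_right _ _

theorem le_priority_iff (hα0 : 0 ≤ α) {j : J} {u x : ℝ} :
    x ≤ S.priority α j u ↔ α * x ≤ (1 - α) * S.y j u ∧ x ≤ S.rem j u := by
  unfold priority
  split_ifs with h
  · subst h
    simpa using fun _ => S.y_nonneg j u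
  · have hα : 0 < α := lt_of_le_of_ne hα0 (Ne.symm h)
    rw [le_min_iff, div_mul_eq_mul_div, le_div_iff₀ hα, mul_comm x α]

theorem lt_priority (hα0 : 0 ≤ α) {j : J} {u x : ℝ}
    (hy : α * x < (1 - α) * S.y j u) (hx : x < S.rem j u) : x < S.priority α j u := by
  unfold priority
  split_ifs with h
  · exact hx
  · have hα : 0 < α := lt_of_le_of_ne hα0 (Ne.symm h)
    rw [lt_min_iff, div_mul_eq_mul_div, lt_div_iff₀ hα, mul_comm x α]
    exact ⟨hy, hx⟩

theorem priority_eq_rem (hα0 : 0 ≤ α) {j : J} {u : ℝ}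
    (h : α * I.p j ≤ S.y j u) : S.priority α j u = S.rem j u := by
  refine le_antisymm (priority_le_rem j u) ((le_priority_iff hα0).2 ⟨?_, le_rfl⟩)
  rw [rem]
  linarith

theorem mem_clairvoyant {j : J} {u : ℝ} :
    j ∈ S.clairvoyant α u ↔ j ∈ S.alive u ∧ (α = 0 ∨ α * I.p j < S.y j u) := by
  simp [clairvoyant]

theorem mem_nonclairvoyant {j : J} {u : ℝ} :
    j ∈ S.nonclairvoyant α u ↔ j ∈ S.alive u ∧ α ≠ 0 ∧ S.y j u ≤ α * I.p j := by
  simp [nonclairvoyant]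

theorem mem_leastProcessed {j : J} {u : ℝ} :
    j ∈ S.leastProcessed α u ↔
      j ∈ S.nonclairvoyant α u ∧ ∀ i ∈ S.nonclairvoyant α u, S.y j u ≤ S.y i u := by
  simp [leastProcessed]

theorem mem_clairvoyant_or_mem_nonclairvoyant {j : J} {u : ℝ} (hj : j ∈ S.alive u) :
    j ∈ S.clairvoyant α u ∨ j ∈ S.nonclairvoyant α u := by
  rw [mem_clairvoyant, mem_nonclairvoyant]
  by_cases h : α = 0
  · exact Or.inl ⟨hj, Or.inl h⟩
  · rcases lt_or_ge (α * I.p j) (S.y j u) with h' | h'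
    · exact Or.inl ⟨hj, Or.inr h'⟩
    · exact Or.inr ⟨hj, h, h'⟩

theorem priority_of_mem_clairvoyant (hα0 : 0 ≤ α) {j : J} {u : ℝ}
    (hj : j ∈ S.clairvoyant α u) : S.priority α j u = S.rem j u := by
  refine priority_eq_rem hα0 ?_
  rcases (mem_clairvoyant.1 hj).2 with rfl | h
  · simpa using S.y_nonneg j u
  · exact h.le

theorem priority_of_mem_nonclairvoyant (hα0 : 0 ≤ α) {j : J} {u : ℝ}
    (hj : j ∈ S.nonclairvoyant α u) : S.priority α j u = (1 - α) / α * S.y j u := by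
  obtain ⟨-, hα, hy⟩ := mem_nonclairvoyant.1 hj
  have hα' : 0 < α := lt_of_le_of_ne hα0 (Ne.symm hα)
  rw [priority, if_neg hα, min_eq_left]
  rw [div_mul_eq_mul_div, div_le_iff₀ hα', rem]
  nlinarith

theorem IsAlgorithmSchedule.priority_le_of_rate_ne_zero (hS : S.IsAlgorithmSchedule α)
    (hα0 : 0 ≤ α) (hα1 : α < 1) {k q : J} {u : ℝ} (hu : 0 ≤ u) (hk : S.rate k u ≠ 0)
    (hq : q ∈ S.alive u) : S.priority α k u ≤ S.priority α q u := by
  by_cases hpref : S.PrefersClairvoyant α u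
  · obtain ⟨k', hk', hmin, -, -, hzero⟩ := (hS u hu).1 hpref
    obtain rfl : k = k' := by
      by_contra hne
      exact hk (hzero k hne)
    obtain ⟨k₀, hk₀, hle⟩ := hpref
    refine (priority_le_rem k u).trans ?_
    rcases mem_clairvoyant_or_mem_nonclairvoyant (α := α) hq with h | h
    · rw [priority_of_mem_clairvoyant hα0 h]
      exact hmin q h
    · rw [priority_of_mem_nonclairvoyant hα0 h]
      exact (hmin k₀ hk₀).trans (hle q h)
  · obtain ⟨-, hzero⟩ := (hS u hu).2 hpref
    have hkl : k ∈ S.leastProcessed α u := by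
      by_contra hne
      exact hk (hzero k hne)
    obtain ⟨hkN, hmin⟩ := mem_leastProcessed.1 hkl
    have hα' : 0 ≤ (1 - α) / α := div_nonneg (by linarith) hα0
    rw [priority_of_mem_nonclairvoyant hα0 hkN]
    rcases mem_clairvoyant_or_mem_nonclairvoyant (α := α) hq with h | h
    · rw [priority_of_mem_clairvoyant hα0 h]
      simp only [PrefersClairvoyant, not_exists, not_and, not_forall, not_le] at hpref
      obtain ⟨j, hj, hlt⟩ := hpref q h
      exact (mul_le_mul_of_nonneg_left (hmin j hj) hα').trans hlt.le
    · rw [priority_of_mem_nonclairvoyant hα0 h]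
      exact mul_le_mul_of_nonneg_left (hmin q h) hα'

theorem IsAlgorithmSchedule.rate_eq_zero (hS : S.IsAlgorithmSchedule α)
    (hα0 : 0 ≤ α) (hα1 : α < 1) {k q : J} {u : ℝ} (hu : 0 ≤ u)
    (hq : q ∈ S.alive u) (hlt : S.priority α q u < S.priority α k u) : S.rate k u = 0 := by
  by_contra hk
  exact absurd (hS.priority_le_of_rate_ne_zero hα0 hα1 hu hk hq) (not_le.2 hlt)

theorem IsAlgorithmSchedule.sum_rate_eq_one (hS : S.IsAlgorithmSchedule α) {u : ℝ} (hu : 0 ≤ u)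
    (hne : (S.alive u).Nonempty) : ∑ j, S.rate j u = 1 := by
  classical
  by_cases hpref : S.PrefersClairvoyant α u
  · obtain ⟨k, -, -, -, hone, hzero⟩ := (hS u hu).1 hpref
    rw [Finset.sum_eq_single k (fun j _ hj => hzero j hj) (by simp), hone]
  · obtain ⟨hrate, hzero⟩ := (hS u hu).2 hpref
    have hN : (S.nonclairvoyant α u).Nonempty := by
      by_contra hN
      rw [Finset.not_nonempty_iff_eq_empty] at hN
      obtain ⟨j, hj⟩ := hne
      rcases mem_clairvoyant_or_mem_nonclairvoyant (α := α) hj with h | h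
      · exact hpref ⟨j, h, by simp [hN]⟩
      · simp [hN] at h
    obtain ⟨k, hk, hmin⟩ := Finset.exists_min_image _ (fun j => S.y j u) hN
    have hk' : k ∈ S.leastProcessed α u := mem_leastProcessed.2 ⟨hk, hmin⟩
    rw [← Finset.sum_subset (Finset.subset_univ (S.leastProcessed α u))
      (fun j _ hj => hzero j hj), Finset.sum_congr rfl hrate, Finset.sum_const, nsmul_eq_mul]
    have : ((S.leastProcessed α u).card : ℝ) ≠ 0 := by
      exact_mod_cast (Finset.card_pos.2 ⟨k, hk'⟩).ne'
    field_simp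

/-- The algorithm never shares the machine between jobs past their signal. -/
theorem IsAlgorithmSchedule.rate_eq_zero_or (hS : S.IsAlgorithmSchedule α) {k k' : J}
    (hne : k ≠ k') {u : ℝ} (hu : 0 ≤ u) (hk : α = 0 ∨ α * I.p k < S.y k u) :
    S.rate k u = 0 ∨ S.rate k' u = 0 := by
  by_cases hpref : S.PrefersClairvoyant α u
  · obtain ⟨k₀, -, -, -, -, hzero⟩ := (hS u hu).1 hpref
    by_cases h : k = k₀
    · exact Or.inr (hzero k' (by rintro rfl; exact hne h))
    · exact Or.inl (hzero k h)
  · obtain ⟨-, hzero⟩ := (hS u hu).2 hpref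
    refine Or.inl (hzero k fun hmem => ?_)
    obtain ⟨-, hα, hy⟩ := mem_nonclairvoyant.1 (mem_leastProcessed.1 hmem).1
    rcases hk with h | h
    · exact hα h
    · linarith

end Schedule

namespace Schedule

variable {J : Type*} [Fintype J] {I : SchedInstance J} {S : Schedule I} {α : ℝ}

/-- There is a last time `s` in `[0, t]` up to which no alive job of priority less than `x` is left
over. -/
theorem exists_threshold_time (S : Schedule I) (α x : ℝ) {t : ℝ} (ht : 0 ≤ t) :
    ∃ s, 0 ≤ s ∧ s ≤ t ∧ (∀ u ∈ Ioc s t, ∃ q ∈ S.alive u, S.priority α q u < x) ∧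
      ∀ j, I.r j < s → S.y j s = I.p j ∨ x ≤ S.priority α j s := by
  set B : Set ℝ := insert 0 {u | 0 ≤ u ∧ u ≤ t ∧ ∀ q ∈ S.alive u, x ≤ S.priority α q u} with hB
  have hbdd : BddAbove B := ⟨t, by rintro u (rfl | hu); exacts [ht, hu.2.1]⟩
  have h0B : (0 : ℝ) ∈ B := Or.inl rfl
  have h0 : 0 ≤ sSup B := le_csSup hbdd h0B
  refine ⟨sSup B, h0, csSup_le ⟨0, h0B⟩ (by rintro u (rfl | hu); exacts [ht, hu.2.1]), ?_, ?_⟩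
  · intro u hu
    by_contra! hcon
    exact absurd (le_csSup hbdd (Or.inr ⟨h0.trans hu.1.le, hu.2, hcon⟩)) (not_le.2 hu.1)
  · intro j hj
    by_contra! hcon
    obtain ⟨hy, hx⟩ := hcon
    have hev : ∀ᶠ u in 𝓝 (sSup B), 0 < u ∧ I.r j < u ∧ S.y j u < I.p j ∧ S.priority α j u < x :=
      (eventually_gt_nhds ((I.r_nonneg j).trans_lt hj)).and <|
        (eventually_gt_nhds hj).and <|
        ((S.continuous_y j).continuousAt.eventually_lt_const (lt_of_le_of_ne (S.y_le j _) hy)).and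
        ((continuous_priority j).continuousAt.eventually_lt_const hx)
    obtain ⟨ε, hε, hball⟩ := Metric.eventually_nhds_iff.1 hev
    obtain ⟨u, huB, hu⟩ := exists_lt_of_lt_csSup ⟨0, h0B⟩ (sub_lt_self (sSup B) hε)
    have hle := le_csSup hbdd huB
    have hd : dist u (sSup B) < ε := by
      rw [Real.dist_eq, abs_lt]
      constructor <;> linarith
    obtain ⟨h1, h2, h3, h4⟩ := hball hd
    rcases huB with rfl | huB
    · exact lt_irrefl _ h1
    · exact absurd (huB.2.2 j (S.mem_alive.2 ⟨h2.le, h3⟩)) (not_le.2 h4)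

/-- A job released after `s` has received little processing if only jobs of priority less than `x`
are processed after `s`. -/
theorem IsAlgorithmSchedule.y_le_of_le_release (hS : S.IsAlgorithmSchedule α) (hα0 : 0 ≤ α)
    (hα1 : α < 1) {x s t : ℝ} (hx : 0 ≤ x) (hs : 0 ≤ s) (hst : s ≤ t)
    (hbusy : ∀ u ∈ Ioc s t, ∃ q ∈ S.alive u, S.priority α q u < x) {j : J} (hj : s ≤ I.r j) :
    (1 - α) * S.y j t ≤ x := by
  have h1α : 0 < 1 - α := by linarith
  by_cases hp : (1 - α) * I.p j ≤ x
  · exact (mul_le_mul_of_nonneg_left (S.y_le j t) h1α.le).trans hp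
  push Not at hp
  have hmul : (1 - α) * (α * x / (1 - α)) = α * x := by field_simp
  have hle : S.y j t ≤ α * x / (1 - α) := by
    refine S.y_le_of_ae_rate_eq_zero (b := I.p j - x) hst ?_ ?_ ?_
    · rw [div_lt_iff₀ h1α]
      linarith
    · rw [S.y_eq_zero hj]
      positivity
    · refine Eventually.of_forall fun u hu hlo hhi => ?_
      obtain ⟨q, hq, hqx⟩ := hbusy u hu
      refine hS.rate_eq_zero hα0 hα1 (hs.trans hu.1.le) hq (hqx.trans (lt_priority hα0 ?_ ?_))
      · rw [div_lt_iff₀ h1α] at hlo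
        linarith
      · rw [rem]
        linarith
  have := mul_le_mul_of_nonneg_left hle h1α.le
  rw [hmul] at this
  nlinarith

/-- A job whose priority is at least `x`, and whose remaining processing time is more than `x`, is
not processed while there are alive jobs of smaller priority. -/
theorem IsAlgorithmSchedule.y_eq_of_lt_rem (hS : S.IsAlgorithmSchedule α) (hα0 : 0 ≤ α)
    (hα1 : α < 1) {x s t : ℝ} (hs : 0 ≤ s) (hst : s ≤ t)
    (hbusy : ∀ u ∈ Ioc s t, ∃ q ∈ S.alive u, S.priority α q u < x) {j : J}
    (hj : x ≤ S.priority α j s) (hrem : x < S.rem j s) : S.y j t = S.y j s := by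
  refine le_antisymm ?_ (S.y_mono j hst)
  obtain ⟨hlo', -⟩ := (le_priority_iff hα0).1 hj
  rw [rem] at hrem
  refine S.y_le_of_ae_rate_eq_zero (b := I.p j - x) hst (by linarith) le_rfl
    (Eventually.of_forall fun u hu hlo hhi => ?_)
  obtain ⟨q, hq, hqx⟩ := hbusy u hu
  refine hS.rate_eq_zero hα0 hα1 (hs.trans hu.1.le) hq (hqx.trans (lt_priority hα0 ?_ ?_))
  · nlinarith
  · rw [rem]
    linarith

/-- A job past its signal is not processed beyond remaining processing time `x` while there are
alive jobs of priority less than `x`. -/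
theorem IsAlgorithmSchedule.le_rem_of_le_rem (hS : S.IsAlgorithmSchedule α) (hα0 : 0 ≤ α)
    (hα1 : α < 1) {x s t : ℝ} (hs : 0 ≤ s)
    (hbusy : ∀ u ∈ Ioc s t, ∃ q ∈ S.alive u, S.priority α q u < x) {k : J}
    (hxk : x ≤ (1 - α) * I.p k) {u₀ : ℝ} (hu₀ : u₀ ∈ Ioc s t) (hk : x ≤ S.rem k u₀) :
    x ≤ S.rem k t := by
  set T : Set ℝ := Icc u₀ t ∩ {u | x ≤ S.rem k u} with hT
  have hTc : IsCompact T :=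
    isCompact_Icc.inter_right (isClosed_le continuous_const (S.continuous_rem k))
  obtain ⟨⟨hav, hvt⟩, hxv⟩ := hTc.sSup_mem ⟨u₀, ⟨le_rfl, hu₀.2⟩, hk⟩
  set v := sSup T
  have hxv : x ≤ S.rem k v := hxv
  rcases eq_or_lt_of_le hvt with heq | hvt'
  · rwa [← heq]
  exfalso
  have hsv : s < v := hu₀.1.trans_le hav
  obtain ⟨q, hq, hqx⟩ := hbusy v ⟨hsv, hvt⟩
  obtain ⟨l, hql, hlx⟩ := exists_between hqx
  obtain ⟨hrq, hyq⟩ := S.mem_alive.1 hq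
  have hev : ∀ᶠ u in 𝓝 v, S.y q u < I.p q ∧ S.priority α q u < l :=
    ((S.continuous_y q).continuousAt.eventually_lt_const hyq).and
      ((continuous_priority q).continuousAt.eventually_lt_const hql)
  obtain ⟨ε, hε, hball⟩ := Metric.eventually_nhds_iff.1 hev
  set w := min t (v + ε / 2)
  have hvw : v < w := lt_min hvt' (by linarith)
  have hw : S.y k w ≤ I.p k - x := by
    refine S.y_le_of_ae_rate_eq_zero (s := v) (b := I.p k - l) hvw.le (by linarith) ?_ ?_
    · rw [rem] at hxv
      linarith
    · refine Eventually.of_forall fun u hu hlo hhi => ?_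
      have hd : dist u v < ε := by
        have : u ≤ v + ε / 2 := hu.2.trans (min_le_right _ _)
        rw [Real.dist_eq, abs_lt]
        constructor <;> linarith [hu.1]
      obtain ⟨h1, h2⟩ := hball hd
      refine hS.rate_eq_zero hα0 hα1 (by linarith [hu.1])
        (S.mem_alive.2 ⟨hrq.trans hu.1.le, h1⟩) (h2.trans ?_)
      rw [priority_eq_rem hα0 (by linarith), rem]
      linarith
  have hwT : w ∈ T := ⟨⟨hav.trans hvw.le, min_le_left _ _⟩, by
    change x ≤ S.rem k w
    rw [rem]
    linarith⟩
  exact absurd (le_csSup hTc.bddAbove hwT) (not_le.2 hvw)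

/-- Past their signals, of two alive jobs with different remaining processing times only the smaller
one is processed, so the difference does not shrink. -/
theorem IsAlgorithmSchedule.rem_sub_rem_mono (hS : S.IsAlgorithmSchedule α) (hα0 : 0 ≤ α)
    (hα1 : α < 1) {k k' : J} {a b : ℝ} (ha : 0 ≤ a) (hab : a ≤ b) (hrk : I.r k ≤ a)
    (hyk : S.y k b < I.p k) (hk : α * I.p k ≤ S.y k a) (hk' : α * I.p k' ≤ S.y k' a)
    (hlt : S.rem k a < S.rem k' a) :
    S.rem k' a - S.rem k a ≤ S.rem k' b - S.rem k b := by
  refine le_of_ae_nonneg_of_mem_Ioo (f := fun u => S.rem k' u - S.rem k u)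
    (h := fun u => S.rate k u - S.rate k' u) (l := 0)
    ((S.continuous_rem k').sub (S.continuous_rem k)) (fun a b => ?_) hab (by linarith) le_rfl
    (Eventually.of_forall fun u hu hpos _ => ?_)
  · rw [intervalIntegral.integral_sub (S.intervalIntegrable_rate k a b)
      (S.intervalIntegrable_rate k' a b), ← S.y_sub_y, ← S.y_sub_y]
    simp only [rem]
    ring
  · have hzero : S.rate k' u = 0 := by
      refine hS.rate_eq_zero (q := k) hα0 hα1 (ha.trans hu.1.le) (S.mem_alive.2
        ⟨hrk.trans hu.1.le, (S.y_mono k hu.2).trans_lt hyk⟩) ?_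
      rw [priority_eq_rem hα0 (hk.trans (S.y_mono k hu.1.le)),
        priority_eq_rem hα0 (hk'.trans (S.y_mono k' hu.1.le))]
      linarith
    rw [hzero, sub_zero]
    exact S.rate_nonneg k u

/-- Two alive jobs past their signals with the same remaining processing time are not both
processed. -/
theorem IsAlgorithmSchedule.le_rem_of_rem_le (hS : S.IsAlgorithmSchedule α) (hα0 : 0 ≤ α)
    (hα1 : α < 1) {k k' : J} (hne : k ≠ k') {x s e : ℝ} (hs : 0 ≤ s) (hse : s ≤ e)
    (hrk : I.r k ≤ s) (hrk' : I.r k' ≤ s) (hyk : S.y k e < I.p k) (hyk' : S.y k' e < I.p k')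
    (hk : S.rem k s = x) (hk' : S.rem k' s = x) (hxk : x ≤ (1 - α) * I.p k)
    (hxk' : x ≤ (1 - α) * I.p k') (hle : S.rem k e ≤ S.rem k' e) : x ≤ S.rem k' e := by
  have hαk : α * I.p k ≤ S.y k s := by rw [rem] at hk; linarith
  have hαk' : α * I.p k' ≤ S.y k' s := by rw [rem] at hk'; linarith
  set T : Set ℝ := Icc s e ∩ {u | S.rem k' u ≤ S.rem k u} with hT
  have hTc : IsCompact T :=
    isCompact_Icc.inter_right (isClosed_le (S.continuous_rem k') (S.continuous_rem k))
  obtain ⟨⟨hsv, hve⟩, hv⟩ := hTc.sSup_mem ⟨s, ⟨le_rfl, hse⟩, by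
    change S.rem k' s ≤ S.rem k s
    rw [hk, hk']⟩
  set v := sSup T
  have hv : S.rem k' v ≤ S.rem k v := hv
  have hafter : S.y k' e ≤ S.y k' v := by
    refine S.y_le_of_ae_rate_eq_zero (b := S.y k' v + 1) hve (by linarith) le_rfl
      (Eventually.of_forall fun u hu _ _ => ?_)
    have hu' : S.rem k u < S.rem k' u := by
      by_contra! hcon
      exact absurd (le_csSup hTc.bddAbove ⟨⟨hsv.trans hu.1.le, hu.2⟩, hcon⟩) (not_le.2 hu.1)
    have hsu : s ≤ u := hsv.trans hu.1.le
    refine hS.rate_eq_zero (q := k) hα0 hα1 (hs.trans hsu) (S.mem_alive.2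
      ⟨hrk.trans hsu, (S.y_mono k hu.2).trans_lt hyk⟩) ?_
    rwa [priority_eq_rem hα0 (hαk.trans (S.y_mono k hsu)),
      priority_eq_rem hα0 (hαk'.trans (S.y_mono k' hsu))]
  have heq : ∀ u ∈ Icc s v, S.rem k' u = S.rem k u := by
    intro u hu
    rcases lt_trichotomy (S.rem k' u) (S.rem k u) with h | h | h
    · have := hS.rem_sub_rem_mono hα0 hα1 (hs.trans hu.1) (hu.2.trans hve) (hrk'.trans hu.1) hyk'
        (hαk'.trans (S.y_mono k' hu.1)) (hαk.trans (S.y_mono k hu.1)) h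
      linarith
    · exact h
    · have := hS.rem_sub_rem_mono hα0 hα1 (hs.trans hu.1) hu.2 (hrk.trans hu.1)
        ((S.y_mono k hve).trans_lt hyk) (hαk.trans (S.y_mono k hu.1))
        (hαk'.trans (S.y_mono k' hu.1)) h
      linarith
  have hbefore : S.y k' v ≤ S.y k' s := by
    refine S.y_le_of_ae_rate_eq_zero (b := S.y k' s + 1) hsv (by linarith) le_rfl ?_
    have hnev : ∀ᵐ u : ℝ, u ≠ v := by simp [ae_iff, measure_singleton]
    filter_upwards [S.ae_hasDerivAt_y k, S.ae_hasDerivAt_y k', hnev] with u hd hd' hnev hu hlo _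
    have hnhds : S.y k' =ᶠ[𝓝 u] fun w => S.y k w + (I.p k' - I.p k) := by
      filter_upwards [Ioo_mem_nhds hu.1 (lt_of_le_of_ne hu.2 hnev)] with w hw
      have := heq w ⟨hw.1.le, hw.2.le⟩
      simp only [rem] at this
      linarith
    have hrate : S.rate k' u = S.rate k u :=
      hd'.unique ((hd.add_const (I.p k' - I.p k)).congr_of_eventuallyEq hnhds)
    rcases hS.rate_eq_zero_or hne.symm (hs.trans hu.1.le) (Or.inr (hαk'.trans_lt hlo)) with h | h
    · exact h
    · rw [hrate, h]
  rw [rem] at hk' ⊢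
  linarith

/-- At most one of the jobs with remaining processing time `x` at time `s` is processed as long as
there are alive jobs of priority less than `x`. -/
theorem IsAlgorithmSchedule.eq_of_rem_lt (hS : S.IsAlgorithmSchedule α) (hα0 : 0 ≤ α)
    (hα1 : α < 1) {k k' : J} {x s t : ℝ} (hx : 0 < x) (hs : 0 ≤ s) (hst : s ≤ t)
    (hbusy : ∀ u ∈ Ioc s t, ∃ q ∈ S.alive u, S.priority α q u < x)
    (hrk : I.r k ≤ s) (hrk' : I.r k' ≤ s) (hk : S.rem k s = x) (hk' : S.rem k' s = x)
    (hxk : x ≤ (1 - α) * I.p k) (hxk' : x ≤ (1 - α) * I.p k')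
    (hkt : S.rem k t < x) (hkt' : S.rem k' t < x) : k = k' := by
  by_contra hne
  have hst' : s < t := lt_of_le_of_ne hst (by rintro rfl; linarith)
  have hev : ∀ᶠ u in 𝓝[>] s, S.y k u < I.p k ∧ S.y k' u < I.p k' ∧ u ≤ t ∧ s < u := by
    refine Eventually.and (nhdsWithin_le_nhds ?_) (Eventually.and (nhdsWithin_le_nhds ?_)
      (Eventually.and (nhdsWithin_le_nhds (eventually_le_nhds hst')) self_mem_nhdsWithin))
    · exact (S.continuous_y k).continuousAt.eventually_lt_const (by rw [rem] at hk; linarith)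
    · exact (S.continuous_y k').continuousAt.eventually_lt_const (by rw [rem] at hk'; linarith)
  obtain ⟨e, h1, h2, het, hse⟩ := hev.exists
  rcases le_total (S.rem k e) (S.rem k' e) with h | h
  · have := hS.le_rem_of_rem_le hα0 hα1 hne hs hse.le hrk hrk' h1 h2 hk hk' hxk hxk' h
    linarith [hS.le_rem_of_le_rem hα0 hα1 hs hbusy hxk' ⟨hse, het⟩ this]
  · have := hS.le_rem_of_rem_le hα0 hα1 (Ne.symm hne) hs hse.le hrk' hrk h2 h1 hk' hk hxk' hxk h
    linarith [hS.le_rem_of_le_rem hα0 hα1 hs hbusy hxk ⟨hse, het⟩ this]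

end Schedule

namespace Schedule

variable {J : Type*} [Fintype J] {I : SchedInstance J} {S : Schedule I} {α : ℝ}

theorem y_eq_p_of_notMem_alive {j : J} {t : ℝ} (hr : I.r j ≤ t) (hj : j ∉ S.alive t) :
    S.y j t = I.p j := by
  rw [S.mem_alive, not_and, not_lt] at hj
  exact le_antisymm (S.y_le j t) (hj hr)

/-- The jobs of small remaining processing time that are alive in the algorithm's schedule but not
in another schedule have, up to one threshold `x`, no more remaining volume than the algorithm has
spent on jobs that are alive in the other schedule. The summand `x` is only needed if some job has
processing time at least `x`. -/
theorem IsAlgorithmSchedule.exists_sum_rem_le [DecidableEq J] (hS : S.IsAlgorithmSchedule α)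
    (hα0 : 0 ≤ α) (hα1 : α < 1) (S' : Schedule I) {x t : ℝ} (hx : 0 < x) (ht : 0 ≤ t) :
    ∃ E, (E = 0 ∨ E = x ∧ ∃ k, x ≤ I.p k) ∧
      ∑ j ∈ S.alive t \ S'.alive t with S.rem j t < x, S.rem j t ≤
        E + ∑ i ∈ S'.alive t with (1 - α) * S.y i t ≤ x, S.y i t := by
  obtain ⟨s, hs, hst, hbusy, hold⟩ := S.exists_threshold_time α x ht
  set D : Finset J := {j ∈ S.alive t \ S'.alive t | S.rem j t < x} with hD
  set O : Finset J := {i ∈ S'.alive t | (1 - α) * S.y i t ≤ x} with hO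
  have hcand : ∀ j, I.r j < s → S.y j t ≠ S.y j s →
      S.rem j s = x ∧ x ≤ (1 - α) * I.p j ∧ S.rem j t < x := by
    intro j hj hne
    have hlt : S.y j s < S.y j t := lt_of_le_of_ne (S.y_mono j hst) hne.symm
    rcases hold j hj with h | h
    · linarith [S.y_le j t]
    · have hrem : S.rem j s = x := by
        refine le_antisymm ?_ (h.trans (priority_le_rem j s))
        by_contra! hcon
        exact hne (hS.y_eq_of_lt_rem hα0 hα1 hs hst hbusy h hcon)
      have h1 := ((le_priority_iff hα0).1 h).1
      simp only [rem] at hrem ⊢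
      refine ⟨hrem, ?_, by linarith⟩
      rw [← hrem] at h1 ⊢
      linarith
  have hDold : ∀ j ∈ D, I.r j < s → S.y j t ≠ S.y j s := by
    intro j hj hjs heq
    rw [hD, Finset.mem_filter, Finset.mem_sdiff, S.mem_alive] at hj
    rcases hold j hjs with h | h
    · linarith [hj.1.1.2]
    · have := h.trans (priority_le_rem j s)
      rw [rem, ← heq] at this
      have h2 := hj.2
      rw [rem] at h2
      linarith
  have hsum := S.sum_y_sub_y_eq hst fun u hu =>
    hS.sum_rate_eq_one (hs.trans hu.1.le) ((hbusy u hu).imp fun _ h => h.1)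
  have hsum' := S'.sum_y_sub_y_le s t hst
  rw [← Finset.sum_filter_add_sum_filter_not Finset.univ (fun j => I.r j < s)] at hsum hsum'
  have hold' : 0 ≤ ∑ j with I.r j < s, (S'.y j t - S'.y j s) :=
    Finset.sum_nonneg fun j _ => sub_nonneg.2 (S'.y_mono j hst)
  have hnew : ∑ j with ¬ I.r j < s, (if j ∈ D then S.rem j t else 0) ≤
      ∑ j with ¬ I.r j < s, (S'.y j t - S'.y j s) - ∑ j with ¬ I.r j < s, (S.y j t - S.y j s) +
        ∑ j with ¬ I.r j < s, if j ∈ O then S.y j t else 0 := by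
    rw [← Finset.sum_sub_distrib, ← Finset.sum_add_distrib]
    refine Finset.sum_le_sum fun j hj => ?_
    have hsj : s ≤ I.r j := by simpa using hj
    rw [S.y_eq_zero hsj, S'.y_eq_zero hsj]
    by_cases hjO : j ∈ S'.alive t
    · have h1 : j ∉ D := by simp [hD, hjO]
      have h2 : j ∈ O := Finset.mem_filter.2
        ⟨hjO, hS.y_le_of_le_release hα0 hα1 hx.le hs hst hbusy hsj⟩
      rw [if_neg h1, if_pos h2]
      linarith [S'.y_nonneg j t]
    · have h2 : j ∉ O := by simp [hO, hjO]
      rw [if_neg h2]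
      rcases le_or_gt (I.r j) t with hr | hr
      · rw [y_eq_p_of_notMem_alive hr hjO]
        split_ifs
        · rw [rem]
          linarith
        · linarith [S.y_le j t]
      · have h1 : j ∉ D := by simp [hD, S.mem_alive, hr]
        rw [if_neg h1, S.y_eq_zero hr.le, S'.y_eq_zero hr.le]
        simp
  have hOsum : ∑ j with ¬ I.r j < s, (if j ∈ O then S.y j t else 0) ≤ ∑ i ∈ O, S.y i t := by
    calc _ ≤ ∑ j, (if j ∈ O then S.y j t else 0) :=
          Finset.sum_le_sum_of_subset_of_nonneg (Finset.filter_subset _ _) fun j _ _ => by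
            split_ifs
            exacts [S.y_nonneg j t, le_rfl]
      _ = ∑ i ∈ O, S.y i t := by simp
  have hDsum : ∑ j ∈ D, S.rem j t =
      ∑ j with I.r j < s, (if j ∈ D then S.rem j t else 0) +
        ∑ j with ¬ I.r j < s, (if j ∈ D then S.rem j t else 0) := by
    rw [Finset.sum_filter_add_sum_filter_not]
    simp
  suffices h : ∃ E, (E = 0 ∨ E = x ∧ ∃ k, x ≤ I.p k) ∧
      ∑ j with I.r j < s, ((if j ∈ D then S.rem j t else 0) + (S.y j t - S.y j s)) ≤ E by
    obtain ⟨E, hE, hle⟩ := h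
    rw [Finset.sum_add_distrib] at hle
    exact ⟨E, hE, by linarith⟩
  by_cases hc : ∃ c, I.r c < s ∧ S.y c t ≠ S.y c s
  · obtain ⟨c, hcs, hc⟩ := hc
    obtain ⟨hc1, hc2, hc3⟩ := hcand c hcs hc
    refine ⟨x, Or.inr ⟨rfl, c, hc2.trans ?_⟩, ?_⟩
    · nlinarith [I.p_pos c]
    · rw [Finset.sum_eq_single c]
      · rw [rem] at hc1 hc3 ⊢
        split_ifs <;> linarith [S.y_le c t]
      · intro j hj hjc
        have hjs : I.r j < s := by simpa using hj
        have heq : S.y j t = S.y j s := by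
          by_contra hne
          obtain ⟨h1, h2, h3⟩ := hcand j hjs hne
          exact hjc (hS.eq_of_rem_lt hα0 hα1 hx hs hst hbusy hjs.le hcs.le h1 hc1 h2 hc2 h3 hc3)
        rw [if_neg fun h => hDold j h hjs heq, heq]
        simp
      · intro h
        simp [hcs] at h
  · push Not at hc
    refine ⟨0, Or.inl rfl, (Finset.sum_eq_zero fun j hj => ?_).le⟩
    have hjs : I.r j < s := by simpa using hj
    rw [if_neg fun h => hDold j h hjs (hc j hjs), hc j hjs]
    simp

end Schedule

/-- If, for every `u`, the sum of the `a j ≤ u` is at most `K` times the sum of the `b i ≤ u`, then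
there are at most `K` times as many `a`s as `b`s. -/
theorem card_le_mul_card_of_forall_sum_le {ι κ : Type*} (A : Finset ι) (B : Finset κ) (a : ι → ℝ)
    (b : κ → ℝ) {K : ℝ} (hK : 0 ≤ K) (ha : ∀ j ∈ A, 0 < a j) (hb : ∀ i ∈ B, 0 ≤ b i)
    (h : ∀ u, ∑ j ∈ A with a j ≤ u, a j ≤ K * ∑ i ∈ B with b i ≤ u, b i) :
    (A.card : ℝ) ≤ K * B.card := by
  classical
  have hint : ∀ c : ℝ, 0 < c →
      Integrable (fun u : ℝ => (Ioi c).indicator (fun u => c * u ^ (-2 : ℝ)) u) := fun c hc =>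
    (integrable_indicator_iff measurableSet_Ioi).2
      ((integrableOn_Ioi_rpow_of_lt (by norm_num) hc).const_mul c)
  have hval : ∀ c : ℝ, 0 < c →
      ∫ u, (Ioi c).indicator (fun u => c * u ^ (-2 : ℝ)) u = 1 := by
    intro c hc
    rw [integral_indicator measurableSet_Ioi, integral_const_mul,
      integral_Ioi_rpow_of_lt (by norm_num) hc]
    norm_num [Real.rpow_neg_one]
    field_simp
  set B' : Finset κ := {i ∈ B | 0 < b i} with hB'
  have hB'pos : ∀ i ∈ B', 0 < b i := fun i hi => (Finset.mem_filter.1 hi).2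
  have hcard : (A.card : ℝ) ≤ K * B'.card := by
    calc (A.card : ℝ)
        = ∫ u, ∑ j ∈ A, (Ioi (a j)).indicator (fun u => a j * u ^ (-2 : ℝ)) u := by
          rw [integral_finsetSum _ fun j hj => hint _ (ha j hj),
            Finset.sum_congr rfl fun j hj => hval _ (ha j hj)]
          simp
      _ ≤ ∫ u, K * ∑ i ∈ B', (Ioi (b i)).indicator (fun u => b i * u ^ (-2 : ℝ)) u := by
          refine integral_mono_ae (integrable_finsetSum _ fun j hj => hint _ (ha j hj))
            ((integrable_finsetSum _ fun i hi => hint _ (hB'pos i hi)).const_mul K) ?_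
          have hnull : ∀ᵐ u : ℝ, ∀ i ∈ B', u ≠ b i := by
            rw [Finset.eventually_all]
            intro i _
            simp [ae_iff, measure_singleton]
          filter_upwards [hnull] with u hu
          have hsum : ∑ i ∈ B with b i ≤ u, b i = ∑ i ∈ B', if b i < u then b i else 0 := by
            rw [hB', Finset.sum_filter, Finset.sum_filter]
            refine Finset.sum_congr rfl fun i hi => ?_
            rcases (hb i hi).eq_or_lt with h0 | h0
            · simp [← h0]
            · have := hu i (Finset.mem_filter.2 ⟨hi, h0⟩)
              rw [if_pos h0]
              refine if_congr ⟨fun h => lt_of_le_of_ne h this.symm, le_of_lt⟩ rfl rfl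
          have hle : ∑ j ∈ A, (if a j < u then a j else 0) ≤ ∑ j ∈ A with a j ≤ u, a j := by
            rw [Finset.sum_filter]
            refine Finset.sum_le_sum fun j hj => ?_
            split_ifs with h1 h2 h2
            · exact le_rfl
            · exact absurd h1.le h2
            · exact (ha j hj).le
            · exact le_rfl
          have hnn : 0 ≤ u ^ (-2 : ℝ) := by
            rw [show (-2 : ℝ) = ((-2 : ℤ) : ℝ) by norm_num, Real.rpow_intCast]
            exact (Even.zpow_nonneg (by decide) u)
          have key := mul_le_mul_of_nonneg_right (hle.trans ((h u).trans_eq (by rw [hsum]))) hnn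
          rw [Finset.sum_mul, mul_assoc, Finset.sum_mul] at key
          simpa only [indicator_apply, mem_Ioi, ite_mul, zero_mul] using key
      _ = K * B'.card := by
          rw [integral_const_mul, integral_finsetSum _ fun i hi => hint _ (hB'pos i hi),
            Finset.sum_congr rfl fun i hi => hval _ (hB'pos i hi)]
          simp
  exact hcard.trans (mul_le_mul_of_nonneg_left
    (by exact_mod_cast Finset.card_filter_le _ _) hK)

/-- If, for every `x`, the sum of the `a j ≤ x` is at most `x` plus `K` times the sum of the
`b i ≤ x`, then the number of `a`s is at most `K + 1` times the number of `b`s, plus one. -/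
theorem card_le_of_forall_sum_le_add {ι κ : Type*} [DecidableEq ι] (A : Finset ι) (B : Finset κ)
    (a : ι → ℝ) (b : κ → ℝ) {K : ℝ} (hK : 0 ≤ K) (ha : ∀ j ∈ A, 0 < a j) (hb : ∀ i ∈ B, 0 ≤ b i)
    (h : ∀ x, 0 < x → ∑ j ∈ A with a j ≤ x, a j ≤ x + K * ∑ i ∈ B with b i ≤ x, b i) :
    (A.card : ℝ) ≤ (K + 1) * B.card + 1 := by
  classical
  rcases A.eq_empty_or_nonempty with rfl | ⟨j₁, -⟩
  · simp only [Finset.card_empty, Nat.cast_zero]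
    positivity
  have : Nonempty ι := ⟨j₁⟩
  -- the largest of the values `0` and `b i` that is at most `a j`
  set L : Finset ℝ := insert 0 (B.image b) with hL
  have hex : ∀ j, ∃ v ∈ L, 0 < a j → v ≤ a j ∧ ∀ w ∈ L, w ≤ a j → w ≤ v := by
    intro j
    by_cases hj : 0 < a j
    · obtain ⟨v, hv, hmax⟩ := Finset.exists_max_image {w ∈ L | w ≤ a j} id
        ⟨0, by simp [hL, hj.le]⟩
      rw [Finset.mem_filter] at hv
      exact ⟨v, hv.1, fun _ => ⟨hv.2, fun w hw hwj => hmax w (Finset.mem_filter.2 ⟨hw, hwj⟩)⟩⟩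
    · exact ⟨0, by simp [hL], fun h => absurd h hj⟩
  choose φ hφL hφ using hex
  have hφ0 : ∀ j ∈ A, 0 ≤ φ j := fun j hj => (hφ j (ha j hj)).2 0 (by simp [hL]) (ha j hj).le
  -- the largest `a j` in every fibre of `φ`
  have htop : ∀ v ∈ A.image φ, ∃ T ∈ A, φ T = v ∧ ∀ j ∈ A, φ j = v → a j ≤ a T := by
    intro v hv
    obtain ⟨j₀, hj₀, rfl⟩ := Finset.mem_image.1 hv
    obtain ⟨T, hT, hmax⟩ := Finset.exists_max_image {j ∈ A | φ j = φ j₀} a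
      ⟨j₀, by simp [hj₀]⟩
    rw [Finset.mem_filter] at hT
    exact ⟨T, hT.1, hT.2, fun j hj hjv => hmax j (Finset.mem_filter.2 ⟨hj, hjv⟩)⟩
  choose! top htopA htopφ htopmax using htop
  set tops : Finset ι := (A.image φ).image top with htops
  have hcardtops : tops.card ≤ B.card + 1 := by
    calc tops.card ≤ (A.image φ).card := Finset.card_image_le
      _ ≤ L.card := Finset.card_le_card (Finset.image_subset_iff.2 fun j _ => hφL j)
      _ ≤ (B.image b).card + 1 := Finset.card_insert_le _ _
      _ ≤ B.card + 1 := by gcongr; exact Finset.card_image_le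
  have hbound : ∀ u, ∑ j ∈ A \ tops with φ j ≤ u, a j ≤ K * ∑ i ∈ B with b i ≤ u, b i := by
    intro u
    have hsumB : 0 ≤ ∑ i ∈ B with b i ≤ u, b i :=
      Finset.sum_nonneg fun i hi => hb i (Finset.mem_filter.1 hi).1
    rcases (Finset.filter (fun v => v ≤ u) (A.image φ)).eq_empty_or_nonempty with hemp | hne
    · rw [Finset.sum_eq_zero]
      · positivity
      · intro j hj
        simp only [Finset.mem_filter, Finset.mem_sdiff] at hj
        have : φ j ∈ Finset.filter (fun v => v ≤ u) (A.image φ) :=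
          Finset.mem_filter.2 ⟨Finset.mem_image_of_mem _ hj.1.1, hj.2⟩
        simp [hemp] at this
    · obtain ⟨v, hv, hmax⟩ := Finset.exists_max_image _ id hne
      rw [Finset.mem_filter] at hv
      set T := top v
      have hTA : T ∈ A := htopA v hv.1
      have hTv : φ T = v := htopφ v hv.1
      have hsub : insert T {j ∈ A \ tops | φ j ≤ u} ⊆ {j ∈ A | a j ≤ a T} := by
        intro j hj
        rw [Finset.mem_insert] at hj
        rcases hj with rfl | hj
        · exact Finset.mem_filter.2 ⟨hTA, le_rfl⟩
        · simp only [Finset.mem_filter, Finset.mem_sdiff] at hj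
          refine Finset.mem_filter.2 ⟨hj.1.1, ?_⟩
          by_contra! hlt
          have h1 : φ j ≤ v := hmax (φ j)
            (Finset.mem_filter.2 ⟨Finset.mem_image_of_mem _ hj.1.1, hj.2⟩)
          have h2 : φ T ≤ φ j := (hφ j (ha j hj.1.1)).2 _ (hφL T)
            ((hφ T (ha T hTA)).1.trans hlt.le)
          exact absurd (htopmax v hv.1 j hj.1.1 (le_antisymm h1 (hTv ▸ h2))) (not_le.2 hlt)
      have hTnot : T ∉ ({j ∈ A \ tops | φ j ≤ u} : Finset ι) := by
        simp only [Finset.mem_filter, Finset.mem_sdiff, not_and]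
        exact fun h' => absurd (Finset.mem_image_of_mem _ hv.1) h'.2
      have h1 := Finset.sum_le_sum_of_subset_of_nonneg hsub
        fun j hj _ => (ha j (Finset.mem_filter.1 hj).1).le
      rw [Finset.sum_insert hTnot] at h1
      have h2 : ∑ i ∈ B with b i ≤ a T, b i ≤ ∑ i ∈ B with b i ≤ u, b i := by
        refine Finset.sum_le_sum_of_subset_of_nonneg (fun i hi => ?_)
          fun i hi _ => hb i (Finset.mem_filter.1 hi).1
        rw [Finset.mem_filter] at hi ⊢
        have := (hφ T (ha T hTA)).2 (b i)
          (Finset.mem_insert_of_mem (Finset.mem_image_of_mem _ hi.1)) hi.2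
        exact ⟨hi.1, by linarith [hv.2]⟩
      have h3 := mul_le_mul_of_nonneg_left h2 hK
      linarith [h (a T) (ha T hTA)]
  have hpos : ∀ j ∈ A \ tops, 0 < φ j := by
    intro j hj
    have hjA := (Finset.mem_sdiff.1 hj).1
    refine lt_of_le_of_ne (hφ0 j hjA) fun h0 => ?_
    have h1 := hbound 0
    rw [Finset.sum_eq_zero (s := {i ∈ B | b i ≤ 0}) fun i hi =>
      le_antisymm (Finset.mem_filter.1 hi).2 (hb i (Finset.mem_filter.1 hi).1), mul_zero] at h1
    have h2 : a j ≤ ∑ j ∈ A \ tops with φ j ≤ 0, a j :=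
      Finset.single_le_sum (f := a) (fun i hi =>
        (ha i (Finset.mem_sdiff.1 (Finset.mem_filter.1 hi).1).1).le)
        (Finset.mem_filter.2 ⟨hj, h0.ge⟩)
    linarith [ha j hjA]
  have hrest := card_le_mul_card_of_forall_sum_le (A \ tops) B φ b hK hpos hb fun u =>
    (Finset.sum_le_sum fun j hj =>
      (hφ j (ha j (Finset.mem_sdiff.1 (Finset.mem_filter.1 hj).1).1)).1).trans (hbound u)
  have hsplit : (A.card : ℝ) ≤ (A \ tops).card + tops.card := by
    exact_mod_cast Finset.card_le_card_sdiff_add_card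
  have : (tops.card : ℝ) ≤ B.card + 1 := by exact_mod_cast hcardtops
  linarith

namespace Schedule

variable {J : Type*} [Fintype J] {I : SchedInstance J} {S : Schedule I} {α : ℝ}

theorem rem_pos_of_mem_alive {j : J} {t : ℝ} (hj : j ∈ S.alive t) : 0 < S.rem j t :=
  sub_pos.2 (S.mem_alive.1 hj).2

theorem alive_eq_empty_of_neg {t : ℝ} (ht : t < 0) : S.alive t = ∅ := by
  refine Finset.eq_empty_of_forall_notMem fun j hj => ?_
  linarith [(S.mem_alive.1 hj).1, I.r_nonneg j]

/-- When a schedule has no alive jobs, neither has the algorithm. -/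
theorem IsAlgorithmSchedule.alive_eq_empty [DecidableEq J] (hS : S.IsAlgorithmSchedule α)
    (hα0 : 0 ≤ α) (hα1 : α < 1) {S' : Schedule I} {t : ℝ} (ht : 0 ≤ t)
    (h : S'.alive t = ∅) : S.alive t = ∅ := by
  refine Finset.eq_empty_of_forall_notMem fun j hj => ?_
  have hp : ∀ k, I.p k < ∑ i, I.p i + 1 := fun k => by
    linarith [Finset.single_le_sum (fun i _ => (I.p_pos i).le) (Finset.mem_univ k)]
  obtain ⟨E, hE, hle⟩ := hS.exists_sum_rem_le hα0 hα1 S' ((I.p_pos j).trans (hp j)) ht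
  obtain rfl : E = 0 := by
    rcases hE with hE | ⟨-, k, hk⟩
    · exact hE
    · linarith [hp k]
  simp only [h, Finset.sdiff_empty, Finset.filter_empty, Finset.sum_empty, add_zero] at hle
  have hj' : j ∈ ({i ∈ S.alive t | S.rem i t < ∑ i, I.p i + 1} : Finset J) :=
    Finset.mem_filter.2 ⟨hj, by rw [rem]; linarith [hp j, S.y_nonneg j t]⟩
  have := Finset.single_le_sum (f := fun i => S.rem i t)
    (fun i hi => (rem_pos_of_mem_alive (Finset.mem_filter.1 hi).1).le) hj'
  linarith [rem_pos_of_mem_alive hj]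

theorem IsAlgorithmSchedule.sum_rem_le [DecidableEq J] (hS : S.IsAlgorithmSchedule α)
    (hα0 : 0 ≤ α) (hα1 : α < 1) (S' : Schedule I) {x t : ℝ} (hx : 0 < x) (ht : 0 ≤ t) :
    ∑ j ∈ S.alive t \ S'.alive t with S.rem j t ≤ x, S.rem j t ≤
      x + ∑ i ∈ S'.alive t with (1 - α) * S.y i t ≤ x, S.y i t := by
  have hev : ∀ᶠ x' in 𝓝[>] x, ∑ j ∈ S.alive t \ S'.alive t with S.rem j t ≤ x, S.rem j t ≤
      x' + ∑ i ∈ S'.alive t with (1 - α) * S.y i t ≤ x, S.y i t := by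
    have hO : ∀ᶠ x' in 𝓝[>] x, ∀ i ∈ S'.alive t, (1 - α) * S.y i t ≤ x' →
        (1 - α) * S.y i t ≤ x := by
      rw [Finset.eventually_all]
      intro i _
      rcases le_or_gt ((1 - α) * S.y i t) x with h | h
      · exact Eventually.of_forall fun _ _ => h
      · filter_upwards [nhdsWithin_le_nhds (eventually_lt_nhds h)] with x' hx' hle
        linarith
    filter_upwards [hO, self_mem_nhdsWithin] with x' hO hx'
    have hx' : x < x' := hx'
    obtain ⟨E, hE, hle⟩ := hS.exists_sum_rem_le hα0 hα1 S' (hx.trans hx') ht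
    have hE' : E ≤ x' := by
      rcases hE with rfl | ⟨rfl, -⟩
      · linarith
      · exact le_rfl
    have hD : ∑ j ∈ S.alive t \ S'.alive t with S.rem j t ≤ x, S.rem j t ≤
        ∑ j ∈ S.alive t \ S'.alive t with S.rem j t < x', S.rem j t :=
      Finset.sum_le_sum_of_subset_of_nonneg
        (Finset.monotone_filter_right _ fun j _ hj => hj.trans_lt hx')
        fun j hj _ => (rem_pos_of_mem_alive
          (Finset.mem_sdiff.1 (Finset.mem_filter.1 hj).1).1).le
    have hOsum : ∑ i ∈ S'.alive t with (1 - α) * S.y i t ≤ x', S.y i t ≤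
        ∑ i ∈ S'.alive t with (1 - α) * S.y i t ≤ x, S.y i t :=
      Finset.sum_le_sum_of_subset_of_nonneg
        (fun i hi => Finset.mem_filter.2 ⟨(Finset.mem_filter.1 hi).1,
          hO i (Finset.mem_filter.1 hi).1 (Finset.mem_filter.1 hi).2⟩)
        fun i _ _ => S.y_nonneg i t
    linarith
  refine ge_of_tendsto ?_ hev
  exact (tendsto_id.mono_left nhdsWithin_le_nhds).add_const _

theorem IsAlgorithmSchedule.card_alive_sdiff_le [DecidableEq J] (hS : S.IsAlgorithmSchedule α)
    (hα0 : 0 ≤ α) (hα1 : α < 1) (S' : Schedule I) {t : ℝ} (ht : 0 ≤ t) :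
    ((S.alive t \ S'.alive t).card : ℝ) ≤ (1 / (1 - α) + 1) * (S'.alive t).card + 1 := by
  have h1α : 0 < 1 - α := by linarith
  refine card_le_of_forall_sum_le_add _ _ (fun j => S.rem j t) (fun i => (1 - α) * S.y i t)
    (by positivity) (fun j hj => rem_pos_of_mem_alive (Finset.mem_sdiff.1 hj).1)
    (fun i _ => mul_nonneg h1α.le (S.y_nonneg i t)) fun x hx => ?_
  have hsum : 1 / (1 - α) * ∑ i ∈ S'.alive t with (1 - α) * S.y i t ≤ x, (1 - α) * S.y i t =
      ∑ i ∈ S'.alive t with (1 - α) * S.y i t ≤ x, S.y i t := by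
    rw [← Finset.mul_sum, ← mul_assoc, one_div_mul_cancel h1α.ne', one_mul]
  rw [hsum]
  exact hS.sum_rem_le hα0 hα1 S' hx ht

end Schedule

/-- The bound holds against every feasible schedule `S'`; its optimality is not used. -/
theorem mainTheorem3 {J : Type*} [Fintype J] [DecidableEq J] (I : SchedInstance J)
    (α : ℝ) (hα0 : 0 ≤ α) (hα1 : α < 1)
    (S : Schedule I) (hS : S.IsAlgorithmSchedule α)
    (S' : Schedule I) (hS' : S'.IsOptimal) (t : ℝ) :
    ((S.alive t \ S'.alive t).card : ℝ) ≤ (3 + 2 / (1 - α)) * ((S'.alive t).card : ℝ) := by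
  rcases lt_or_ge t 0 with ht | ht
  · simp [Schedule.alive_eq_empty_of_neg ht]
  rcases (S'.alive t).eq_empty_or_nonempty with hO | hO
  · simp [hO, hS.alive_eq_empty hα0 hα1 ht hO]
  · have hcard : (1 : ℝ) ≤ (S'.alive t).card := by exact_mod_cast hO.card_pos
    have hK : 0 ≤ 1 / (1 - α) := one_div_nonneg.2 (by linarith)
    have h2 : 2 / (1 - α) = 2 * (1 / (1 - α)) := by ring
    rw [h2]
    nlinarith [hS.card_alive_sdiff_le hα0 hα1 S' ht, mul_nonneg hK (zero_le_one.trans hcard)]
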